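/- **Conventions.** A metric measure space $(X,d,\mu)$ is a separable metric space with a locally finite Borel regular (outer) measure $\mu$ such that $\mu(V)=\sup\{\mu(K):K\subseteq V\text{ compact}\}$ for open $V$. For a distance $D$ on $X$, a map $g$ from $X$ to a metric space and $x\in A\subseteq X$, let $\operatorname{Lip}_D(g|_A;x)=\limsup_{A\ni y\to x,\,y\neq x} d(g(x),g(y))/D(x,y)$, which is $0$ if $x$ is isolated in $A$. Put $D(A,x)=\inf_{a\in A}D(a,x)$ (with $\inf\varnothing=\infty$), $B_D(A,r)=\{x: D(A,x)\le r\}$, $U_D(A,r)=\{x:D(A,x)<r\}$. A set $E\subseteq X$ is porous w.r.t. $D$ if for each $x\in E$ there are $\epsilon>0$ and $y_i\to x$ with $E\cap B_D(y_i,\epsilon D(x,y_i))=\varnothing$ for all $i$. Let $Y$ be a real Banach space. For $\varphi:X\to\mathbb R^n$, a map $f:X\to Y$ is $\varphi$-differentiable at $x$ w.r.t. $D$ if there is a unique linear $T:\mathbb R^n\to Y$ with $\operatorname{Lip}_D(f-T\circ\varphi;x)=0$; $T$ is then the Cheeger differential. A Cheeger atlas of $(X,d,\mu)$ is a countable family $\{(U_j,\varphi_j:X\to\mathbb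 R^{n_j})\}_j$ ($n_j\ge 0$) with $U_j$ $\mu$-measurable, $\varphi_j$ $d$-Lipschitz, $\mu(X\setminus\bigcup_jU_j)=0$, such that every $d$-Lipschitz $f:X\to Y$ is $\varphi_j$-differentiable w.r.t. $d$ at $\mu$-a.e. $x\in U_j$, for every $j$. A $Y$-LDS is a metric measure space that has a Cheeger atlas. $(X,d)$ has shortcuts $\{(\mathcal J_i,\delta_i)\}_i$ if $\delta_i>0$, $\delta_i\to0$, each $\mathcal J_i$ is a non-empty family of disjoint subsets of $X$, and there are constants $a,a_0,b,M>0$ such that, for all $i$ and $S\in\mathcal J_i$: $a_0\delta_i\le d(x,y)\le a\delta_i$ for distinct $x,y\in S$; $d(S,S')\ge b\delta_j$ for $S'\in\mathcal J_j$, $S'\ne S$, $i\le j$; $d(x,y)\le d(x,z)+d(w,y)$ for $x,y\notin U_d(S,b\delta_i)$ and $z,w\in S$; $2\le\#S\le M$; and $B_d(\bigcup\mathcal J_i,M\delta_i)=X$. A Cheeger atlas is compatible with the shortcuts if every $\varphi_j$ is constant on every $S\in\bigcup_i\mathcal J_i$; $(X,d,\mu)$ is a $Y$-LDS with compatible shortcuts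 if it is a $Y$-LDS, has shortcuts, and has a compatible atlas. Given $\eta_i\in(0,1]$, put $\rho_\eta(x,y)=\eta_i d(x,y)$ if $x,y\in S\in\mathcal J_i$ (the least such value, should $S$ belong to several $\mathcal J_i$) and $\rho_\eta(x,y)=d(x,y)$ otherwise; $d_\eta(x,y)$ is the infimum of $\sum_{k=1}^n\rho_\eta(x_{k-1},x_k)$ over finite chains $x=x_0,\dots,x_n=y$. For $f:X\to Y$ and $\epsilon>0$ let $\mathcal J_i^\epsilon(f)=\{S\in\mathcal J_i:\operatorname{diam}f(S)\ge\epsilon\eta_i\delta_i\}$ and $$\operatorname{Bad}(f)=\bigcup_{\epsilon>0}\limsup_{i\to\infty}B_{d_\eta}\Big(\bigcup\mathcal J_i^\epsilon(f),\,\eta_i\delta_i/\epsilon\Big).$$ **Theorem.** Let $Y$ be a real Banach space, $(X,d,\mu)$ a $Y$-LDS with compatible shortcuts $\{(\mathcal J_i,\delta_i)\}_i$, let $\eta=(\eta_i)\subseteq(0,1]$, and suppose that $\mu(E)=0$ for every $E\subseteq X$ porous w.r.t. $d_\eta$. Let $f:(X,d_\eta)\to Y$ be Lipschitz and let $\{(U_j,\varphi_j)\}_j$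 be any compatible atlas. Then, for every $j$: 1. $f$ is $\varphi_j$-differentiable w.r.t. $d_\eta$ at $\mu$-a.e. $x\in U_j\setminus\operatorname{Bad}(f)$; 2. for every $A\subseteq\operatorname{Bad}(f)$ (measurable or not), neither $f$ nor its restriction to $(A,d_\eta)$ is $\varphi_j$-differentiable at $\mu$-a.e. $x\in A\cap U_j$; precisely, for $\mu$-a.e. $x\in A\cap U_j$ and every linear $T:\mathbb R^{n_j}\to Y$, $\operatorname{Lip}_{d_\eta}(f-T\circ\varphi_j;x)>0$ and $\operatorname{Lip}_{d_\eta}((f-T\circ\varphi_j)|_A;x)>0$; 3. at $\mu$-a.e. $x\in U_j\setminus\operatorname{Bad}(f)$ the $\varphi_j$-differentials of $f$ w.r.t. $d$ and w.r.t. $d_\eta$ both exist and agree. -/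

import Mathlib

open Set Filter Topology MeasureTheory

noncomputable section

namespace Shortcut

/-! ### Metric notions relative to a distance function

The same set `X` carries two distances, so the metric notions below take the distance
`D : X → X → ℝ` as an explicit argument. -/

section Metric

variable {X : Type*} {Z : Type*} [PseudoMetricSpace Z]

/-- `f : (X, D) → Z` is Lipschitz. -/
def IsLipschitz (D : X → X → ℝ) (f : X → Z) : Prop :=
  ∃ L : ℝ, 0 ≤ L ∧ ∀ x y, dist (f x) (f y) ≤ L * D x y

/-- The pointwise Lipschitz constant `Lip(f|_A; x)`, for `x ∈ A`, of the restriction of `f` to the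
subspace `A` of `(X, D)`: the limsup of `dist (f x) (f y) / D x y` as `y → x` with `y ∈ A`, `y ≠ x`.
It is `0` when `x` is an isolated point of `A` (the filter is then trivial). -/
def lipAtWithin (D : X → X → ℝ) (A : Set X) (f : X → Z) (x : X) : ENNReal :=
  limsup (fun y => ENNReal.ofReal (dist (f x) (f y) / D x y))
    (comap (D x) (𝓝[>] (0 : ℝ)) ⊓ 𝓟 A)

/-- The pointwise Lipschitz constant `Lip(f; x)` on `(X, D)`. -/
def lipAt (D : X → X → ℝ) (f : X → Z) (x : X) : ENNReal :=
  lipAtWithin D univ f x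

/-- Distance from a set to a point; it is `∞` for the empty set. -/
def setDist (D : X → X → ℝ) (A : Set X) (x : X) : ENNReal :=
  ⨅ a ∈ A, ENNReal.ofReal (D a x)

/-- The closed neighbourhood `B(A, r)`; it is empty if `A` is. -/
def closedNhd (D : X → X → ℝ) (A : Set X) (r : ℝ) : Set X :=
  {x | setDist D A x ≤ ENNReal.ofReal r}

/-- The open neighbourhood `U(A, r)`. -/
def openNhd (D : X → X → ℝ) (A : Set X) (r : ℝ) : Set X :=
  {x | setDist D A x < ENNReal.ofReal r}

/-- `E` is porous at `x` with respect to `D`. -/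
def IsPorousAt (D : X → X → ℝ) (E : Set X) (x : X) : Prop :=
  ∃ ε : ℝ, 0 < ε ∧ ∃ y : ℕ → X, Tendsto (fun i => D x (y i)) atTop (𝓝 0) ∧
    ∀ i, E ∩ closedNhd D {y i} (ε * D x (y i)) = ∅

/-- `E` is porous (at each of its points) with respect to `D`. -/
def IsPorous (D : X → X → ℝ) (E : Set X) : Prop :=
  ∀ x ∈ E, IsPorousAt D E x

end Metric

/-! ### Cheeger differentials and Lipschitz differentiability spaces -/

section Cheeger

variable {X : Type*} {Y : Type*} [NormedAddCommGroup Y] [NormedSpace ℝ Y]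

/-- `T` is the `φ`-differential at `x` of the restriction of `f` to the subspace `A` of `(X, D)`:
the unique linear map with `Lip((f - T ∘ φ)|_A; x) = 0`. -/
def IsCheegerDifferentialWithin (D : X → X → ℝ) (A : Set X) {n : ℕ}
    (φ : X → EuclideanSpace ℝ (Fin n)) (f : X → Y) (x : X)
    (T : EuclideanSpace ℝ (Fin n) →ₗ[ℝ] Y) : Prop :=
  lipAtWithin D A (fun y => f y - T (φ y)) x = 0 ∧
    ∀ T' : EuclideanSpace ℝ (Fin n) →ₗ[ℝ] Y,
      lipAtWithin D A (fun y => f y - T' (φ y)) x = 0 → T' = T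

/-- `T` is the `φ`-differential of `f` at `x` on `(X, D)`. -/
def IsCheegerDifferential (D : X → X → ℝ) {n : ℕ}
    (φ : X → EuclideanSpace ℝ (Fin n)) (f : X → Y) (x : X)
    (T : EuclideanSpace ℝ (Fin n) →ₗ[ℝ] Y) : Prop :=
  IsCheegerDifferentialWithin D univ φ f x T

/-- A countable collection of pairs `(U_i, φ_i : X → ℝ^{n_i})`. -/
structure ChartFamily (X : Type*) where
  ι : Type
  countable : Countable ι
  U : ι → Set X
  dim : ι → ℕ
  φ : (i : ι) → X → EuclideanSpace ℝ (Fin (dim i))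

/-- `𝒜` is a Cheeger atlas of `(X, D, μ)` for maps with values in `Y`. For the σ-finite Borel
regular measures considered, null-measurable is the same as Carathéodory measurable. -/
def IsCheegerAtlas [MeasurableSpace X] (Y : Type*) [NormedAddCommGroup Y] [NormedSpace ℝ Y]
    (D : X → X → ℝ) (μ : Measure X) (𝒜 : ChartFamily X) : Prop :=
  (∀ i, NullMeasurableSet (𝒜.U i) μ) ∧
  (∀ i, IsLipschitz D (𝒜.φ i)) ∧
  μ (⋃ i, 𝒜.U i)ᶜ = 0 ∧
  ∀ f : X → Y, IsLipschitz D f → ∀ i, ∀ᵐ x ∂μ, x ∈ 𝒜.U i →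
    ∃ T, IsCheegerDifferential D (𝒜.φ i) f x T

/-- Metric measure space: a separable metric space with a locally finite measure that is inner
regular by compact sets on open sets. A Mathlib measure on the Borel σ-algebra, evaluated on
arbitrary sets, is exactly a Borel regular outer measure. -/
def IsMetricMeasureSpace [MetricSpace X] [MeasurableSpace X] (μ : Measure X) : Prop :=
  BorelSpace X ∧ TopologicalSpace.SeparableSpace X ∧ IsLocallyFiniteMeasure μ ∧
    μ.InnerRegularWRT IsCompact IsOpen

/-- `(X, d, μ)` is a `Y`-Lipschitz differentiability space. -/
def IsLDS [MetricSpace X] [MeasurableSpace X] (Y : Type*) [NormedAddCommGroup Y]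
    [NormedSpace ℝ Y] (μ : Measure X) : Prop :=
  IsMetricMeasureSpace μ ∧ ∃ 𝒜 : ChartFamily X, IsCheegerAtlas Y dist μ 𝒜

end Cheeger

/-! ### Shortcuts and the shortcut distance -/

section Shortcuts

variable {X : Type*} [MetricSpace X]

/-- The metric space `X` has shortcuts `{(J i, δ i)}_i`. -/
def HasShortcuts (J : ℕ → Set (Set X)) (δ : ℕ → ℝ) : Prop :=
  (∀ i, 0 < δ i) ∧ Tendsto δ atTop (𝓝 0) ∧
  (∀ i, (J i).Nonempty) ∧ (∀ i, (J i).PairwiseDisjoint id) ∧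
  ∃ a a₀ b M : ℝ, 0 < a ∧ 0 < a₀ ∧ 0 < b ∧ 0 < M ∧
    (∀ i, ∀ S ∈ J i, ∀ x ∈ S, ∀ y ∈ S, x ≠ y → a₀ * δ i ≤ dist x y ∧ dist x y ≤ a * δ i) ∧
    (∀ i j, i ≤ j → ∀ S ∈ J i, ∀ S' ∈ J j, S ≠ S' →
      ∀ x ∈ S, ∀ y ∈ S', b * δ j ≤ dist x y) ∧
    (∀ i, ∀ S ∈ J i, ∀ x ∉ openNhd dist S (b * δ i), ∀ y ∉ openNhd dist S (b * δ i),
      ∀ z ∈ S, ∀ w ∈ S, dist x y ≤ dist x z + dist w y) ∧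
    (∀ i, ∀ S ∈ J i, S.Finite ∧ 2 ≤ S.ncard ∧ (S.ncard : ℝ) ≤ M) ∧
    (∀ i, closedNhd dist (⋃₀ J i) (M * δ i) = univ)

open Classical in
/-- `ρ_η(x, y)` is `η i * d(x, y)` if `x, y ∈ S ∈ J i`, and `d(x, y)` otherwise. If a shortcut
happens to belong to several `J i`, the least of the corresponding values is taken. -/
def rho (J : ℕ → Set (Set X)) (η : ℕ → ℝ) (x y : X) : ℝ :=
  if ∃ i, ∃ S ∈ J i, x ∈ S ∧ y ∈ S then
    sInf {c | ∃ i, ∃ S ∈ J i, x ∈ S ∧ y ∈ S ∧ c = η i * dist x y}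
  else dist x y

/-- The shortcut distance `d_η`: the infimum of the `ρ_η`-lengths of the chains
`x = p 0, p 1, …, p (n + 1) = y`. -/
def shortcutDist (J : ℕ → Set (Set X)) (η : ℕ → ℝ) (x y : X) : ℝ :=
  sInf {c | ∃ (n : ℕ) (p : ℕ → X), p 0 = x ∧ p (n + 1) = y ∧
    c = ∑ k ∈ Finset.range (n + 1), rho J η (p k) (p (k + 1))}

/-- A Cheeger atlas of `(X, d, μ)` compatible with the shortcuts: every chart map is constant on
every shortcut. -/
def IsCompatibleAtlas [MeasurableSpace X] (Y : Type*) [NormedAddCommGroup Y] [NormedSpace ℝ Y]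
    (μ : Measure X) (J : ℕ → Set (Set X)) (𝒜 : ChartFamily X) : Prop :=
  IsCheegerAtlas Y dist μ 𝒜 ∧ ∀ j, ∀ i, ∀ S ∈ J i, Metric.diam (𝒜.φ j '' S) = 0

/-- `(X, d, μ)` is a `Y`-LDS with compatible shortcuts `{(J i, δ i)}_i`. -/
def IsLDSWithCompatibleShortcuts [MeasurableSpace X] (Y : Type*) [NormedAddCommGroup Y]
    [NormedSpace ℝ Y] (μ : Measure X) (J : ℕ → Set (Set X)) (δ : ℕ → ℝ) : Prop :=
  IsLDS Y μ ∧ HasShortcuts J δ ∧ ∃ 𝒜 : ChartFamily X, IsCompatibleAtlas Y μ J 𝒜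

variable {Y : Type*} [NormedAddCommGroup Y]

/-- The shortcuts `S ∈ J i` with `diam f(S) ≥ ε η_i δ_i`. -/
def largeShortcuts (J : ℕ → Set (Set X)) (δ η : ℕ → ℝ) (f : X → Y) (ε : ℝ) (i : ℕ) :
    Set (Set X) :=
  {S ∈ J i | ε * η i * δ i ≤ Metric.diam (f '' S)}

/-- `Bad_ε(f)`. -/
def badEps (J : ℕ → Set (Set X)) (δ η : ℕ → ℝ) (f : X → Y) (ε : ℝ) : Set X :=
  limsup (fun i => closedNhd (shortcutDist J η) (⋃₀ largeShortcuts J δ η f ε i)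
    (η i * δ i / ε)) atTop

/-- `Bad(f)`. -/
def bad (J : ℕ → Set (Set X)) (δ η : ℕ → ℝ) (f : X → Y) : Set X :=
  ⋃ (ε : ℝ) (_ : 0 < ε), badEps J δ η f ε

end Shortcuts

end Shortcut

end

/-!
A chain for `d_η` is a route that alternates moves in `d` with weighted jumps inside shortcuts. A
jump whose level is a local maximum along the route can be left out: in the interior of the route by
the detour property, and at its ends because the length of the jump is at most a multiple of the
adjacent gap. Adjacent jumps in the same shortcut can be merged. Hence every point that is
`d_η`-close to `x` is reached, up to a constant, by a `d`-short move or by a single jump between two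
`d`-short moves.

Let `E` be a set on which `g` has slope at most `ε` with respect to `d` below a fixed scale. At a
point `x ∈ E \ Bad(g)` where `E` is not porous, only the `y ∈ E` near `x` matter, and for them the
two short moves and the jump each contribute at most a multiple of `ε` times `d_η(x, y)`. Hence
`Lip_{d_η}(g; x) ≤ K Lip_d(g; x)` almost everywhere off `Bad(g)`. It is applied to `g = f - T ∘ φ`,
where `T` ranges over a countable set approximating all differentials of `f`; `Bad(g) = Bad(f)`,
because `φ` is constant on shortcuts.

At a point of `Bad(f)`, arbitrarily short shortcuts lie within a multiple of their `d_η`-diameter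
and `f - T ∘ φ` oscillates on them by a fixed proportion of it, so its Lipschitz constant is
positive. Almost every point of a set is one of non-porosity, and there the Lipschitz constant of
the restriction is that of the whole map.
-/

namespace Shortcut

section Metric

variable {X Z W : Type*} [PseudoMetricSpace Z] [PseudoMetricSpace W] {D D' : X → X → ℝ}
  {A B : Set X} {g : X → Z} {x : X}

theorem hasBasis_comap_nhdsGT_inf_principal (D : X → X → ℝ) (A : Set X) (x : X) :
    (comap (D x) (𝓝[>] 0) ⊓ 𝓟 A).HasBasis (fun r : ℝ => 0 < r)
      fun r => D x ⁻¹' Ioo 0 r ∩ A :=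
  ((nhdsGT_basis 0).comap (D x)).inf_principal A

theorem lipAtWithin_le_ofReal {K r : ℝ} (hr : 0 < r)
    (h : ∀ y ∈ A, 0 < D x y → D x y < r → dist (g x) (g y) ≤ K * D x y) :
    lipAtWithin D A g x ≤ ENNReal.ofReal K := by
  refine limsup_le_of_le (by isBoundedDefault) ?_
  filter_upwards [(hasBasis_comap_nhdsGT_inf_principal D A x).mem_of_mem hr] with y hy
  exact ENNReal.ofReal_le_ofReal ((div_le_iff₀ hy.1.1).2 (h y hy.2 hy.1.1 hy.1.2))

theorem IsLipschitz.exists_forall_dist_le_of_lipAtWithin_lt (hg : IsLipschitz D g)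
    (hD : ∀ x y, 0 ≤ D x y) {K : ℝ} (h : lipAtWithin D A g x < ENNReal.ofReal K) :
    ∃ r > 0, ∀ y ∈ A, D x y < r → dist (g x) (g y) ≤ K * D x y := by
  obtain ⟨L, -, hL⟩ := hg
  obtain ⟨r, hr, hrK⟩ := (hasBasis_comap_nhdsGT_inf_principal D A x).mem_iff.1
    (eventually_lt_of_limsup_lt h)
  refine ⟨r, hr, fun y hyA hyr => ?_⟩
  rcases (hD x y).eq_or_lt with h0 | h0
  · simpa [← h0] using hL x y
  have hy : ENNReal.ofReal (dist (g x) (g y) / D x y) < ENNReal.ofReal K :=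
    hrK ⟨⟨h0, hyr⟩, hyA⟩
  exact (div_le_iff₀ h0).1 ((ENNReal.ofReal_lt_ofReal_iff_of_nonneg (by positivity)).1 hy).le

theorem le_of_forall_lt_ofReal_add {α β : ENNReal}
    (h : ∀ K e : ℝ, 0 < e → β < ENNReal.ofReal K → α ≤ ENNReal.ofReal (K + e)) : α ≤ β := by
  refine le_of_forall_gt_imp_ge_of_dense fun c hc => ?_
  obtain ⟨K, hK, hβK, hKc⟩ := ENNReal.lt_iff_exists_real_btwn.1 hc
  obtain ⟨K', -, hKK', hK'c⟩ := ENNReal.lt_iff_exists_real_btwn.1 hKc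
  have hlt : K < K' := (ENNReal.ofReal_lt_ofReal_iff_of_nonneg hK).1 hKK'
  simpa using (h K (K' - K) (sub_pos.2 hlt) hβK).trans (by simpa using hK'c.le)

theorem lipAtWithin_mono (h : A ⊆ B) (g : X → Z) (x : X) :
    lipAtWithin D A g x ≤ lipAtWithin D B g x :=
  limsup_le_limsup_of_le (inf_le_inf_left _ (principal_mono.2 h))

theorem IsLipschitz.mono (hg : IsLipschitz D g) (h : ∀ x y, D x y ≤ D' x y) :
    IsLipschitz D' g := by
  obtain ⟨L, hL, hg⟩ := hg
  exact ⟨L, hL, fun x y => (hg x y).trans (mul_le_mul_of_nonneg_left (h x y) hL)⟩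

theorem IsLipschitz.lipAtWithin_anti (hg : IsLipschitz D g) (hD : ∀ x y, 0 ≤ D x y)
    (h : ∀ x y, D x y ≤ D' x y) (A : Set X) (x : X) :
    lipAtWithin D' A g x ≤ lipAtWithin D A g x := by
  refine le_of_forall_lt_ofReal_add fun K e he hK => ?_
  obtain ⟨r, hr, hrK⟩ := hg.exists_forall_dist_le_of_lipAtWithin_lt hD hK
  have hK0 : 0 < K := ENNReal.ofReal_pos.1 (hK.trans_le' bot_le)
  refine lipAtWithin_le_ofReal hr fun y hyA _ hyr => ?_
  calc dist (g x) (g y) ≤ K * D x y := hrK y hyA ((h x y).trans_lt hyr)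
    _ ≤ (K + e) * D' x y := by gcongr; exacts [hD x y, by linarith, h x y]

theorem lipAtWithin_le_add {g' : X → W} {M : ℝ}
    (h : ∀ y, dist (g x) (g y) ≤ dist (g' x) (g' y) + M * D x y) :
    lipAtWithin D A g x ≤ lipAtWithin D A g' x + ENNReal.ofReal M := by
  rcases (comap (D x) (𝓝[>] 0) ⊓ 𝓟 A).eq_or_neBot with hbot | hne
  · simp [lipAtWithin, hbot]
  rw [lipAtWithin, lipAtWithin, ← limsup_add_const _ _ _ (by isBoundedDefault)
    (by isBoundedDefault)]
  refine limsup_le_limsup ?_ (by isBoundedDefault) (by isBoundedDefault)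
  filter_upwards [(hasBasis_comap_nhdsGT_inf_principal D A x).mem_of_mem one_pos] with y hy
  refine (ENNReal.ofReal_le_ofReal ?_).trans ENNReal.ofReal_add_le
  rw [div_add' _ _ _ hy.1.1.ne']
  exact div_le_div_of_nonneg_right (h y) hy.1.1.le

theorem lipAtWithin_comp_le {K : NNReal} {h : Z → W} (hh : LipschitzWith K h) (g : X → Z) :
    lipAtWithin D A (h ∘ g) x ≤ K * lipAtWithin D A g x := by
  rw [lipAtWithin, lipAtWithin, ← ENNReal.limsup_const_mul_of_ne_top ENNReal.coe_ne_top]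
  refine limsup_le_limsup ?_ (by isBoundedDefault) (by isBoundedDefault)
  filter_upwards [(hasBasis_comap_nhdsGT_inf_principal D A x).mem_of_mem one_pos] with y hy
  rw [← ENNReal.ofReal_coe_nnreal, ← ENNReal.ofReal_mul K.coe_nonneg, ← mul_div_assoc]
  exact ENNReal.ofReal_le_ofReal
    (div_le_div_of_nonneg_right (hh.dist_le_mul _ _) hy.1.1.le)

theorem diam_image_congr {S : Set X} {g' : X → W}
    (h : ∀ z ∈ S, ∀ w ∈ S, dist (g z) (g w) = dist (g' z) (g' w)) :
    Metric.diam (g '' S) = Metric.diam (g' '' S) := by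
  refine congrArg ENNReal.toReal (eq_of_forall_ge_iff fun c => ?_)
  simp only [Metric.ediam_image_le_iff, edist_dist]
  exact forall₄_congr fun z hz w hw => by rw [h z hz w hw]

theorem mem_closedNhd_singleton {y u : X} {r : ℝ} (hr : 0 ≤ r) :
    u ∈ closedNhd D {y} r ↔ D y u ≤ r := by
  simp [closedNhd, setDist, ENNReal.ofReal_le_ofReal_iff hr]

theorem exists_mem_of_not_isPorousAt (hD : ∀ x y, 0 ≤ D x y) (h : ¬ IsPorousAt D A x) {ε : ℝ}
    (hε : 0 < ε) : ∃ r > 0, ∀ y, D x y < r → ∃ u ∈ A, D y u ≤ ε * D x y := by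
  by_contra! hc
  choose y hy hyA using fun i : ℕ => hc (1 / ((i : ℝ) + 1)) (by positivity)
  refine h ⟨ε, hε, y, squeeze_zero (fun i => hD _ _) (fun i => (hy i).le)
    tendsto_one_div_add_atTop_nhds_zero_nat, fun i => eq_empty_of_forall_notMem ?_⟩
  rintro u ⟨hu, huy⟩
  rw [mem_closedNhd_singleton (mul_nonneg hε.le (hD _ _))] at huy
  exact (hyA i u hu).not_ge huy

theorem isPorous_setOf_isPorousAt (D : X → X → ℝ) (E : Set X) :
    IsPorous D {x ∈ E | IsPorousAt D E x} := by
  rintro x ⟨-, ε, hε, y, hy, hE⟩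
  exact ⟨ε, hε, y, hy, fun i => subset_empty_iff.1 <|
    (inter_subset_inter_left _ (sep_subset _ _)).trans (hE i).subset⟩

theorem ae_not_isPorousAt [MeasurableSpace X] {μ : Measure X}
    (hpor : ∀ E, IsPorous D E → μ E = 0) (E : Set X) :
    ∀ᵐ x ∂μ, x ∈ E → ¬ IsPorousAt D E x := by
  simpa [ae_iff] using hpor _ (isPorous_setOf_isPorousAt D E)

theorem IsLipschitz.lipAt_le_lipAtWithin (hg : IsLipschitz D g) (hD : ∀ x y, 0 ≤ D x y)
    (htri : ∀ x y z, D x z ≤ D x y + D y z) (hA : ¬ IsPorousAt D A x) :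
    lipAt D g x ≤ lipAtWithin D A g x := by
  refine le_of_forall_lt_ofReal_add fun K e he hK => ?_
  obtain ⟨r, hr, hrK⟩ := hg.exists_forall_dist_le_of_lipAtWithin_lt hD hK
  have hK0 : 0 < K := ENNReal.ofReal_pos.1 (hK.trans_le' bot_le)
  obtain ⟨L, hL, hg⟩ := hg
  set ε := e / (K + L) with hε
  have hε0 : 0 < ε := by positivity
  obtain ⟨s, hs, hsA⟩ := exists_mem_of_not_isPorousAt hD hA hε0
  refine lipAtWithin_le_ofReal (lt_min hs (div_pos hr (by positivity : 0 < 1 + ε)))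
    fun y _ _ hy => ?_
  obtain ⟨u, huA, hyu⟩ := hsA y (hy.trans_le (min_le_left _ _))
  have hxu : D x u ≤ (1 + ε) * D x y := by linarith [htri x y u]
  have hur : D x u < r :=
    hxu.trans_lt ((lt_div_iff₀' (by positivity)).1 (hy.trans_le (min_le_right _ _)))
  calc dist (g x) (g y) ≤ dist (g x) (g u) + dist (g y) (g u) := dist_triangle_right _ _ _
    _ ≤ K * ((1 + ε) * D x y) + L * (ε * D x y) := by
      gcongr
      · exact (hrK u huA hur).trans (by gcongr)
      · exact (hg y u).trans (by gcongr)
    _ = (K + (K + L) * ε) * D x y := by ring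
    _ = (K + e) * D x y := by rw [hε, mul_div_cancel₀ _ (by positivity)]

end Metric

section ShortcutDist

variable {X : Type*} [MetricSpace X] {J : ℕ → Set (Set X)} {η : ℕ → ℝ}

theorem le_rho {x y : X} {c : ℝ} (hd : c ≤ dist x y)
    (hJ : ∀ i, ∀ S ∈ J i, x ∈ S → y ∈ S → c ≤ η i * dist x y) : c ≤ rho J η x y := by
  unfold rho
  split_ifs with h
  · obtain ⟨i, S, hS, hx, hy⟩ := h
    refine le_csInf ⟨_, i, S, hS, hx, hy, rfl⟩ ?_
    rintro _ ⟨j, S', hS', hx', hy', rfl⟩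
    exact hJ j S' hS' hx' hy'
  · exact hd

theorem rho_nonneg (hη : ∀ i, 0 ≤ η i) (x y : X) : 0 ≤ rho J η x y :=
  le_rho dist_nonneg fun i _ _ _ _ => mul_nonneg (hη i) dist_nonneg

theorem rho_le_of_mem (hη : ∀ i, 0 ≤ η i) {i : ℕ} {S : Set X} (hS : S ∈ J i) {x y : X}
    (hx : x ∈ S) (hy : y ∈ S) : rho J η x y ≤ η i * dist x y := by
  unfold rho
  rw [if_pos ⟨i, S, hS, hx, hy⟩]
  refine csInf_le ⟨0, ?_⟩ ⟨i, S, hS, hx, hy, rfl⟩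
  rintro _ ⟨j, _, _, _, _, rfl⟩
  exact mul_nonneg (hη j) dist_nonneg

theorem rho_le_dist (hη : ∀ i, 0 ≤ η i) (hη1 : ∀ i, η i ≤ 1) (x y : X) :
    rho J η x y ≤ dist x y := by
  by_cases h : ∃ i, ∃ S ∈ J i, x ∈ S ∧ y ∈ S
  · obtain ⟨i, S, hS, hx, hy⟩ := h
    exact (rho_le_of_mem hη hS hx hy).trans (mul_le_of_le_one_left dist_nonneg (hη1 i))
  · simp [rho, h]

theorem rho_comm (x y : X) : rho J η x y = rho J η y x := by
  classical
  unfold rho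
  refine if_congr ?_ (congrArg sInf (ext fun c => ?_)) (dist_comm x y)
  · simp only [and_comm (a := x ∈ _)]
  · simp only [mem_ofPred_eq, dist_comm x y, and_left_comm (a := x ∈ _)]

theorem shortcutDist_le_sum (hη : ∀ i, 0 ≤ η i) (n : ℕ) (p : ℕ → X) :
    shortcutDist J η (p 0) (p (n + 1)) ≤
      ∑ k ∈ Finset.range (n + 1), rho J η (p k) (p (k + 1)) := by
  refine csInf_le ⟨0, ?_⟩ ⟨n, p, rfl, rfl, rfl⟩
  rintro _ ⟨n, p, -, -, rfl⟩
  exact Finset.sum_nonneg fun k _ => rho_nonneg hη _ _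

theorem shortcutDist_le_rho (hη : ∀ i, 0 ≤ η i) (x y : X) :
    shortcutDist J η x y ≤ rho J η x y := by
  simpa using shortcutDist_le_sum (J := J) hη 0 fun k => if k = 0 then x else y

theorem le_shortcutDist_of_forall_sum {x y : X} {c : ℝ}
    (h : ∀ n (p : ℕ → X), p 0 = x → p (n + 1) = y →
      c ≤ ∑ k ∈ Finset.range (n + 1), rho J η (p k) (p (k + 1))) :
    c ≤ shortcutDist J η x y := by
  refine le_csInf ⟨_, 0, fun k => if k = 0 then x else y, by simp, by simp, rfl⟩ ?_
  rintro _ ⟨n, p, hx, hy, rfl⟩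
  exact h n p hx hy

theorem shortcutDist_le_rho_add (hη : ∀ i, 0 ≤ η i) (x y z : X) :
    shortcutDist J η x z ≤ rho J η x y + shortcutDist J η y z := by
  rw [← sub_le_iff_le_add']
  refine le_shortcutDist_of_forall_sum fun n p hy hz => ?_
  rw [sub_le_iff_le_add']
  let q : ℕ → X
    | 0 => x
    | k + 1 => p k
  have h : shortcutDist J η x (p (n + 1)) ≤
      ∑ k ∈ Finset.range (n + 1), rho J η (p k) (p (k + 1)) + rho J η x (p 0) :=
    (shortcutDist_le_sum hη (n + 1) q).trans_eq (Finset.sum_range_succ' _ _)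
  rw [hy, hz] at h
  linarith

theorem le_shortcutDist {F : X → X → ℝ} (hF : ∀ x y, F x y ≤ rho J η x y)
    (hF' : ∀ x y z, F x z ≤ rho J η x y + F y z) (x y : X) : F x y ≤ shortcutDist J η x y := by
  refine le_shortcutDist_of_forall_sum fun n => ?_
  induction n generalizing x with
  | zero => rintro p rfl rfl; simpa using hF (p 0) (p 1)
  | succ n ih =>
    rintro p rfl rfl
    rw [Finset.sum_range_succ']
    have htail := ih (p 1) (fun k => p (k + 1)) rfl rfl
    exact (hF' _ (p 1) _).trans ((add_le_add_right htail _).trans_eq (add_comm _ _))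

theorem shortcutDist_nonneg (hη : ∀ i, 0 ≤ η i) (x y : X) : 0 ≤ shortcutDist J η x y :=
  le_shortcutDist (F := fun _ _ => 0) (rho_nonneg hη)
    (fun x y _ => by simpa using rho_nonneg hη x y) x y

theorem shortcutDist_triangle (hη : ∀ i, 0 ≤ η i) (x y z : X) :
    shortcutDist J η x z ≤ shortcutDist J η x y + shortcutDist J η y z := by
  rw [← sub_le_iff_le_add]
  refine le_shortcutDist (F := fun u v => shortcutDist J η u z - shortcutDist J η v z)
    (fun u v => ?_) (fun u v w => ?_) x y
  · linarith [shortcutDist_le_rho_add (J := J) hη u v z]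
  · linarith [shortcutDist_le_rho_add (J := J) hη u v z]

theorem shortcutDist_comm (hη : ∀ i, 0 ≤ η i) (x y : X) :
    shortcutDist J η x y = shortcutDist J η y x := by
  suffices h : ∀ x y : X, shortcutDist J η y x ≤ shortcutDist J η x y from
    le_antisymm (h y x) (h x y)
  refine le_shortcutDist (fun x y => ?_) fun x y z => ?_
  · exact (shortcutDist_le_rho hη y x).trans_eq (rho_comm y x)
  · have := shortcutDist_triangle (J := J) hη z y x
    linarith [shortcutDist_le_rho (J := J) hη y x, rho_comm (J := J) (η := η) x y]

theorem shortcutDist_le_dist (hη : ∀ i, 0 ≤ η i) (hη1 : ∀ i, η i ≤ 1) (x y : X) :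
    shortcutDist J η x y ≤ dist x y :=
  (shortcutDist_le_rho hη x y).trans (rho_le_dist hη hη1 x y)

theorem shortcutDist_le_of_mem (hη : ∀ i, 0 ≤ η i) {i : ℕ} {S : Set X} (hS : S ∈ J i) {x y : X}
    (hx : x ∈ S) (hy : y ∈ S) : shortcutDist J η x y ≤ η i * dist x y :=
  (shortcutDist_le_rho hη x y).trans (rho_le_of_mem hη hS hx hy)

theorem IsLipschitz.shortcutDist_of_const {Z : Type*} [PseudoMetricSpace Z] {g : X → Z}
    (hg : IsLipschitz dist g) (hη : ∀ i, 0 ≤ η i)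
    (hconst : ∀ i, ∀ S ∈ J i, ∀ x ∈ S, ∀ y ∈ S, dist (g x) (g y) = 0) :
    IsLipschitz (shortcutDist J η) g := by
  obtain ⟨L, hL, hg⟩ := hg
  have hL1 : 0 < L + 1 := by positivity
  have hrho : ∀ x y, dist (g x) (g y) / (L + 1) ≤ rho J η x y := fun x y => by
    refine le_rho ((div_le_iff₀' hL1).2 ((hg x y).trans ?_)) fun i S hS hx hy => ?_
    · gcongr; linarith
    · rw [hconst i S hS x hx y hy, zero_div]
      exact mul_nonneg (hη i) dist_nonneg
  refine ⟨L + 1, hL1.le, fun x y => (div_le_iff₀' hL1).1 ?_⟩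
  refine le_shortcutDist (F := fun x y => dist (g x) (g y) / (L + 1)) hrho (fun x y z => ?_) x y
  calc dist (g x) (g z) / (L + 1)
      ≤ dist (g x) (g y) / (L + 1) + dist (g y) (g z) / (L + 1) := by
        rw [← add_div]; gcongr; exact dist_triangle _ _ _
    _ ≤ rho J η x y + dist (g y) (g z) / (L + 1) := by gcongr; exact hrho x y

end ShortcutDist

section Routes

variable {X : Type*} [MetricSpace X]

/-- The metric conditions in `HasShortcuts`, with named constants: the diameters of the shortcuts
are comparable to their scales, distinct shortcuts are separated, and no path gets shorter by
visiting a shortcut that both of its ends are far from. -/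
structure ShortcutBounds (J : ℕ → Set (Set X)) (δ : ℕ → ℝ) (a a₀ b : ℝ) : Prop where
  pos : ∀ i, 0 < δ i
  tendsto : Tendsto δ atTop (𝓝 0)
  a_pos : 0 < a
  a₀_pos : 0 < a₀
  b_pos : 0 < b
  le_dist : ∀ i, ∀ S ∈ J i, ∀ x ∈ S, ∀ y ∈ S, x ≠ y → a₀ * δ i ≤ dist x y
  dist_le : ∀ i, ∀ S ∈ J i, ∀ x ∈ S, ∀ y ∈ S, dist x y ≤ a * δ i
  separated : ∀ i j, i ≤ j → ∀ S ∈ J i, ∀ S' ∈ J j, S ≠ S' →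
    ∀ x ∈ S, ∀ y ∈ S', b * δ j ≤ dist x y
  detour : ∀ i, ∀ S ∈ J i, ∀ x, (∀ s ∈ S, b * δ i ≤ dist x s) →
    ∀ y, (∀ s ∈ S, b * δ i ≤ dist y s) → ∀ z ∈ S, ∀ w ∈ S, dist x y ≤ dist x z + dist w y

variable {J : ℕ → Set (Set X)} {δ η : ℕ → ℝ} {a a₀ b C : ℝ}

theorem HasShortcuts.exists_shortcutBounds (h : HasShortcuts J δ) :
    ∃ a a₀ b, ShortcutBounds J δ a a₀ b := by
  obtain ⟨hδ, hlim, -, -, a, a₀, b, M, ha, ha₀, hb, -, hdist, hsep, hdet, -, -⟩ := h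
  have hfar : ∀ i (S : Set X) x, (∀ s ∈ S, b * δ i ≤ dist x s) → x ∉ openNhd dist S (b * δ i) :=
    fun i S x hx => not_lt.2 <| le_iInf₂ fun s hs =>
      ENNReal.ofReal_le_ofReal ((hx s hs).trans_eq (dist_comm x s))
  refine ⟨a, a₀, b, hδ, hlim, ha, ha₀, hb, fun i S hS x hx y hy hxy =>
    (hdist i S hS x hx y hy hxy).1, fun i S hS x hx y hy => ?_, hsep, fun i S hS x hx y hy =>
    hdet i S hS x (hfar i S x hx) y (hfar i S y hy)⟩
  by_cases hxy : x = y
  · rw [hxy, dist_self]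
    exact (mul_pos ha (hδ i)).le
  · exact (hdist i S hS x hx y hy hxy).2

/-- A jump between two points of a shortcut. The level is recorded because a set may be a
shortcut of several levels. -/
structure Jump (J : ℕ → Set (Set X)) where
  level : ℕ
  set : Set X
  src : X
  tgt : X
  set_mem : set ∈ J level
  src_mem : src ∈ set
  tgt_mem : tgt ∈ set

/-- The `η`-weighted length of a jump. -/
def Jump.weight (η : ℕ → ℝ) (j : Jump J) : ℝ := η j.level * dist j.src j.tgt

theorem Jump.weight_nonneg (hη : ∀ i, 0 ≤ η i) (j : Jump J) : 0 ≤ j.weight η :=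
  mul_nonneg (hη _) dist_nonneg

/-- The length of the route from `x` to `y` that makes the jumps of a list in turn. The gaps in
front of the jumps are counted `C` times; this surplus pays for jumps that are left out when a
route is simplified. -/
def routeLength (η : ℕ → ℝ) (C : ℝ) (x y : X) : List (Jump J) → ℝ
  | [] => dist x y
  | j :: l => C * dist x j.src + j.weight η + routeLength η C j.tgt y l

theorem routeLength_nonneg (hη : ∀ i, 0 ≤ η i) (hC : 0 ≤ C) (x y : X) (l : List (Jump J)) :
    0 ≤ routeLength η C x y l := by
  induction l generalizing x with
  | nil => exact dist_nonneg
  | cons j l ih =>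
    exact add_nonneg (add_nonneg (mul_nonneg hC dist_nonneg) (j.weight_nonneg hη)) (ih _)

theorem routeLength_le_mul_dist_add (hC : 1 ≤ C) (x x' y : X) (l : List (Jump J)) :
    routeLength η C x y l ≤ C * dist x x' + routeLength η C x' y l := by
  cases l with
  | nil =>
    exact (dist_triangle x x' y).trans
      (add_le_add_left (le_mul_of_one_le_left dist_nonneg hC) _)
  | cons j l =>
    have := mul_le_mul_of_nonneg_left (dist_triangle x x' j.src) (zero_le_one.trans hC)
    simp only [routeLength]
    linarith

theorem exists_routeLength_le_of_shortcutDist_lt (hη : ∀ i, 0 ≤ η i) (hC : 1 ≤ C) {x y : X}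
    {r : ℝ} (h : shortcutDist J η x y < r) :
    ∃ l : List (Jump J), routeLength η C x y l ≤ C * r := by
  have hC0 : 0 < C := zero_lt_one.trans_le hC
  let F : X → X → ℝ := fun x y => (⨅ l : List (Jump J), routeLength η C x y l) / C
  have hF_le {x y : X} {c : ℝ} (l : List (Jump J)) (hl : routeLength η C x y l ≤ C * c) :
      F x y ≤ c :=
    (div_le_iff₀' hC0).2 <| (ciInf_le ⟨0, forall_mem_range.2 fun l =>
      routeLength_nonneg hη hC0.le _ _ l⟩ l).trans hl
  have hle (x y : X) : F x y ≤ rho J η x y := by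
    refine le_rho (hF_le [] (le_mul_of_one_le_left dist_nonneg hC)) fun i S hS hx hy => ?_
    refine hF_le [⟨i, S, x, y, hS, hx, hy⟩] ?_
    simpa [routeLength, Jump.weight] using
      le_mul_of_one_le_left (mul_nonneg (hη i) dist_nonneg) hC
  have hle' (x y z : X) : F x z ≤ rho J η x y + F y z := by
    rw [← sub_le_iff_le_add']
    refine (le_div_iff₀' hC0).2 (le_ciInf fun l => ?_)
    rw [← le_div_iff₀' hC0, sub_le_comm]
    refine le_rho ?_ fun i S hS hx hy => ?_ <;> rw [sub_le_iff_le_add]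
    · refine hF_le l ?_
      rw [mul_add, mul_div_cancel₀ _ hC0.ne']
      exact routeLength_le_mul_dist_add hC x y z l
    · refine hF_le (⟨i, S, x, y, hS, hx, hy⟩ :: l) ?_
      rw [mul_add, mul_div_cancel₀ _ hC0.ne']
      simpa [routeLength, Jump.weight] using
        le_mul_of_one_le_left (mul_nonneg (hη i) dist_nonneg) hC
  obtain ⟨l, hl⟩ := exists_lt_of_ciInf_lt
    ((div_lt_iff₀' hC0).1 ((le_shortcutDist hle hle' x y).trans_lt h))
  exact ⟨l, hl.le⟩

theorem Jump.exists_merge (hη : ∀ i, 0 ≤ η i) (hη1 : ∀ i, η i ≤ 1) (hC : 1 ≤ C) {j k : Jump J}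
    (h : j.set = k.set) : ∃ j' : Jump J, j'.src = j.src ∧ j'.tgt = k.tgt ∧
      j'.weight η ≤ j.weight η + C * dist j.tgt k.src + k.weight η := by
  have hweight (i : ℕ) (hj : η i ≤ η j.level) (hk : η i ≤ η k.level) :
      η i * dist j.src k.tgt ≤ j.weight η + C * dist j.tgt k.src + k.weight η :=
    calc η i * dist j.src k.tgt
        ≤ η i * (dist j.src j.tgt + dist j.tgt k.src + dist k.src k.tgt) :=
          mul_le_mul_of_nonneg_left (dist_triangle4 _ _ _ _) (hη i)
      _ = η i * dist j.src j.tgt + η i * dist j.tgt k.src + η i * dist k.src k.tgt := by ring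
      _ ≤ j.weight η + C * dist j.tgt k.src + k.weight η := by
          unfold Jump.weight
          gcongr
          exact (hη1 i).trans hC
  rcases le_total (η j.level) (η k.level) with hle | hle
  · exact ⟨⟨j.level, j.set, j.src, k.tgt, j.set_mem, j.src_mem, h ▸ k.tgt_mem⟩, rfl, rfl,
      hweight _ le_rfl hle⟩
  · exact ⟨⟨k.level, k.set, j.src, k.tgt, k.set_mem, h ▸ j.src_mem, k.tgt_mem⟩, rfl, rfl,
      hweight _ hle le_rfl⟩

theorem ShortcutBounds.dist_add_gap_le (hJ : ShortcutBounds J δ a a₀ b) (hC : 1 + a / b ≤ C)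
    (k : Jump J) {p s : X} (hfar : b * δ k.level ≤ dist p s) :
    dist k.src k.tgt + dist p s ≤ C * dist p s := by
  have hab := div_pos hJ.a_pos hJ.b_pos
  calc dist k.src k.tgt + dist p s ≤ a * δ k.level + dist p s := by
        gcongr; exact hJ.dist_le _ _ k.set_mem _ k.src_mem _ k.tgt_mem
    _ = a / b * (b * δ k.level) + dist p s := by rw [← mul_assoc, div_mul_cancel₀ _ hJ.b_pos.ne']
    _ ≤ a / b * dist p s + dist p s := by gcongr
    _ = (1 + a / b) * dist p s := by ring
    _ ≤ C * dist p s := by gcongr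

theorem ShortcutBounds.exists_shorter_route (hJ : ShortcutBounds J δ a a₀ b)
    (hη : ∀ i, 0 ≤ η i) (hη1 : ∀ i, η i ≤ 1) (hC : 1 + a / b ≤ C) (y : X) (l : List (Jump J))
    (p : X) (k : Jump J) (hp : ∀ s ∈ k.set, b * δ k.level ≤ dist p s) :
    ∃ l' : List (Jump J), l'.length ≤ l.length ∧
      routeLength η C p y l' ≤ routeLength η C p y (k :: l) := by
  have hC1 : 1 ≤ C := by linarith [div_pos hJ.a_pos hJ.b_pos]
  induction l generalizing p k with
  | nil =>
    refine ⟨[], le_rfl, ?_⟩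
    simp only [routeLength]
    linarith [hJ.dist_add_gap_le hC k (hp _ k.src_mem), dist_triangle4 p k.src k.tgt y,
      k.weight_nonneg hη]
  | cons q r ih =>
    by_cases hkq : k.set = q.set
    · obtain ⟨k', hsrc, htgt, hw⟩ := Jump.exists_merge hη hη1 hC1 hkq
      refine ⟨k' :: r, le_rfl, ?_⟩
      simp only [routeLength, hsrc, htgt]
      linarith
    rcases lt_or_ge k.level q.level with hlt | hge
    · obtain ⟨l', hlen, hle⟩ := ih k.tgt q
        (hJ.separated _ _ hlt.le _ k.set_mem _ q.set_mem hkq _ k.tgt_mem)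
      refine ⟨k :: l', by simpa using hlen, ?_⟩
      simp only [routeLength] at hle ⊢
      linarith
    -- `k` is a local maximum of the level: `detour` allows to leave it out.
    · have hq := hJ.separated _ _ hge _ q.set_mem _ k.set_mem (Ne.symm hkq) _ q.src_mem
      have hdetour := mul_le_mul_of_nonneg_left
        (hJ.detour _ _ k.set_mem p hp q.src hq _ k.src_mem _ k.tgt_mem) (zero_le_one.trans hC1)
      refine ⟨q :: r, le_rfl, ?_⟩
      simp only [routeLength]
      linarith [k.weight_nonneg hη]

theorem ShortcutBounds.exists_single_jump (hJ : ShortcutBounds J δ a a₀ b) (hη : ∀ i, 0 ≤ η i)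
    (hη1 : ∀ i, η i ≤ 1) (hC : 1 + a / b ≤ C) (x y : X) (j : Jump J) (l : List (Jump J)) :
    ∃ k : Jump J, dist x k.src + k.weight η + dist k.tgt y ≤
      dist x j.src + j.weight η + routeLength η C j.tgt y l := by
  have hC1 : 1 ≤ C := by linarith [div_pos hJ.a_pos hJ.b_pos]
  induction hn : l.length using Nat.strong_induction_on generalizing j l with
  | _ n ih =>
  subst hn
  cases l with
  | nil => exact ⟨j, le_rfl⟩
  | cons k l =>
    have hlen : l.length < (k :: l).length := by simp
    by_cases hjk : j.set = k.set
    · obtain ⟨j', hsrc, htgt, hw⟩ := Jump.exists_merge hη hη1 hC1 hjk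
      obtain ⟨q, hq⟩ := ih _ hlen j' l rfl
      rw [hsrc, htgt] at hq
      exact ⟨q, hq.trans (by simp only [routeLength]; linarith)⟩
    rcases lt_or_ge j.level k.level with hlt | hge
    · obtain ⟨l', hlen', hle⟩ := hJ.exists_shorter_route hη hη1 hC y l j.tgt k
        (hJ.separated _ _ hlt.le _ j.set_mem _ k.set_mem hjk _ j.tgt_mem)
      obtain ⟨q, hq⟩ := ih _ (hlen'.trans_lt hlen) j l' rfl
      exact ⟨q, hq.trans (by linarith)⟩
    · obtain ⟨q, hq⟩ := ih _ hlen k l rfl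
      have hgap := hJ.dist_add_gap_le hC j
        (hJ.separated _ _ hge _ k.set_mem _ j.set_mem (Ne.symm hjk) _ k.src_mem _ j.tgt_mem)
      rw [dist_comm k.src j.tgt] at hgap
      refine ⟨q, hq.trans ?_⟩
      simp only [routeLength]
      linarith [dist_triangle4 x j.src j.tgt k.src, j.weight_nonneg hη]

theorem ShortcutBounds.exists_dist_le_or_jump (hJ : ShortcutBounds J δ a a₀ b)
    (hη : ∀ i, 0 ≤ η i) (hη1 : ∀ i, η i ≤ 1) :
    ∃ C : ℝ, 1 ≤ C ∧ ∀ x y r, shortcutDist J η x y < r → dist x y ≤ C * r ∨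
      ∃ i, ∃ S ∈ J i, ∃ z ∈ S, ∃ w ∈ S, dist x z ≤ C * r ∧ dist w y ≤ C * r ∧
        η i * δ i ≤ C * r := by
  set C := 1 + a / b with hC
  have hC1 : 1 ≤ C := by linarith [div_pos hJ.a_pos hJ.b_pos]
  have ha₀ := hJ.a₀_pos
  refine ⟨C * (1 + a₀⁻¹), one_le_mul_of_one_le_of_one_le hC1 (by simp [ha₀.le]),
    fun x y r hr => ?_⟩
  have hr0 : 0 ≤ r := (shortcutDist_nonneg hη x y).trans hr.le
  have hCr : C * r ≤ C * (1 + a₀⁻¹) * r := by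
    gcongr; exact le_mul_of_one_le_right (by positivity) (by simp [ha₀.le])
  obtain ⟨_ | ⟨j, l⟩, hl⟩ := exists_routeLength_le_of_shortcutDist_lt hη hC1 hr
  · exact .inl (hl.trans hCr)
  obtain ⟨k, hk⟩ := hJ.exists_single_jump hη hη1 hC.ge x y j l
  have hjump : dist x k.src + k.weight η + dist k.tgt y ≤ C * r := by
    refine (hk.trans ?_).trans hl
    simp only [routeLength]
    linarith [le_mul_of_one_le_left (dist_nonneg (x := x) (y := j.src)) hC1]
  have hw := k.weight_nonneg hη
  by_cases hne : k.src = k.tgt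
  · left
    rw [hne] at hjump
    linarith [dist_triangle x k.tgt y]
  right
  refine ⟨k.level, k.set, k.set_mem, k.src, k.src_mem, k.tgt, k.tgt_mem, ?_, ?_, ?_⟩
  · linarith [dist_nonneg (x := k.tgt) (y := y)]
  · linarith [dist_nonneg (x := x) (y := k.src)]
  calc η k.level * δ k.level = a₀⁻¹ * (η k.level * (a₀ * δ k.level)) := by field_simp
    _ ≤ a₀⁻¹ * k.weight η := by
      unfold Jump.weight
      gcongr
      exacts [hη _, hJ.le_dist _ _ k.set_mem _ k.src_mem _ k.tgt_mem hne]
    _ ≤ a₀⁻¹ * (C * r) := by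
      gcongr
      linarith [dist_nonneg (x := k.tgt) (y := y), dist_nonneg (x := x) (y := k.src)]
    _ ≤ C * (1 + a₀⁻¹) * r := by nlinarith [mul_nonneg (zero_le_one.trans hC1) hr0]

end Routes

section Differentials

variable {X Y : Type*} [NormedAddCommGroup Y] [NormedSpace ℝ Y] {D D' : X → X → ℝ} {n : ℕ}
  {φ : X → EuclideanSpace ℝ (Fin n)} {f : X → Y} {x : X} {T : EuclideanSpace ℝ (Fin n) →ₗ[ℝ] Y}

theorem lipAtWithin_sub_linear_comp_le {A : Set X} {L : ℝ}
    (hφ : ∀ x y, dist (φ x) (φ y) ≤ L * D x y) (T T' : EuclideanSpace ℝ (Fin n) →L[ℝ] Y) :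
    lipAtWithin D A (fun y => f y - T (φ y)) x ≤
      lipAtWithin D A (fun y => f y - T' (φ y)) x + ENNReal.ofReal (dist T T' * L) := by
  refine lipAtWithin_le_add fun y => ?_
  calc dist (f x - T (φ x)) (f y - T (φ y))
      = dist ((f x - T' (φ x)) - (T - T') (φ x)) ((f y - T' (φ y)) - (T - T') (φ y)) := by simp
    _ ≤ dist (f x - T' (φ x)) (f y - T' (φ y)) + dist ((T - T') (φ x)) ((T - T') (φ y)) :=
        dist_sub_sub_le _ _ _ _
    _ ≤ dist (f x - T' (φ x)) (f y - T' (φ y)) + dist T T' * (L * D x y) := by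
        gcongr
        rw [dist_eq_norm, ← map_sub, dist_eq_norm T T']
        refine (ContinuousLinearMap.le_opNorm _ _).trans ?_
        gcongr
        exact (dist_eq_norm _ _).symm.trans_le (hφ x y)
    _ = _ := by ring

theorem IsLipschitz.sub_linear_comp (hf : IsLipschitz D f) (hφ : IsLipschitz D φ)
    (T : EuclideanSpace ℝ (Fin n) →ₗ[ℝ] Y) : IsLipschitz D fun y => f y - T (φ y) := by
  obtain ⟨L, hL, hf⟩ := hf
  obtain ⟨L', hL', hφ⟩ := hφ
  set T' := LinearMap.toContinuousLinearMap T
  refine ⟨L + ‖T'‖ * L', by positivity, fun x y => ?_⟩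
  calc dist (f x - T (φ x)) (f y - T (φ y))
      ≤ dist (f x) (f y) + dist (T' (φ x)) (T' (φ y)) := dist_sub_sub_le _ _ _ _
    _ ≤ L * D x y + ‖T'‖ * (L' * D x y) :=
        add_le_add (hf x y) ((T'.dist_le_opNorm _ _).trans (by gcongr; exact hφ x y))
    _ = (L + ‖T'‖ * L') * D x y := by ring

theorem IsCheegerDifferential.comp_eq (hT : IsCheegerDifferential D φ f x T) (R : Y →L[ℝ] Y)
    (hR : ∀ y, R (f y) = f y) : (R : Y →ₗ[ℝ] Y) ∘ₗ T = T := by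
  refine hT.2 _ (nonpos_iff_eq_zero.1 ?_)
  have hcomp : (fun y => f y - ((R : Y →ₗ[ℝ] Y) ∘ₗ T) (φ y)) =
      R ∘ fun y => f y - T (φ y) := by
    ext y
    simp [hR]
  rw [hcomp]
  exact (lipAtWithin_comp_le R.lipschitz _).trans_eq (by rw [hT.1, mul_zero])

theorem IsCheegerDifferential.apply_mem (hT : IsCheegerDifferential D φ f x T)
    {V : Submodule ℝ Y} (hV : IsClosed (V : Set Y)) (hf : ∀ y, f y ∈ V)
    (v : EuclideanSpace ℝ (Fin n)) : T v ∈ V := by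
  by_contra hv
  obtain ⟨ℓ, hℓV, hℓ⟩ : ∃ ℓ : Y →L[ℝ] ℝ, (∀ y ∈ V, ℓ y = 0) ∧ ℓ (T v) ≠ 0 := by
    have : IsClosed (V : Set Y) := hV
    obtain ⟨ℓ, hℓ⟩ := SeparatingDual.exists_ne_zero (R := ℝ) (x := V.mkQ (T v)) (by simpa using hv)
    exact ⟨ℓ ∘L V.mkQL, fun y hy => by simp [(Submodule.Quotient.mk_eq_zero V).2 hy], hℓ⟩
  have hid := LinearMap.congr_fun (hT.comp_eq (.id ℝ Y + ℓ.smulRight (T v))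
    fun y => by simp [hℓV _ (hf y)]) v
  have hTv : T v ≠ 0 := fun h => hv (h ▸ V.zero_mem)
  simp [hℓ, hTv] at hid

theorem isSeparable_setOf_isCheegerDifferential (D : X → X → ℝ)
    (φ : X → EuclideanSpace ℝ (Fin n)) (hf : TopologicalSpace.IsSeparable (range f)) :
    TopologicalSpace.IsSeparable
      {T : EuclideanSpace ℝ (Fin n) →L[ℝ] Y | ∃ x, IsCheegerDifferential D φ f x T} := by
  set V := (Submodule.span ℝ (range f)).topologicalClosure with hV
  have hfV (y : X) : f y ∈ V :=
    Submodule.le_topologicalClosure _ (Submodule.subset_span (mem_range_self y))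
  have hsep : TopologicalSpace.IsSeparable (V : Set Y) := by
    rw [hV, Submodule.topologicalClosure_coe]
    exact hf.span.closure
  have : TopologicalSpace.SeparableSpace V := hsep.separableSpace
  have : SecondCountableTopology V := UniformSpace.secondCountable_of_separable V
  refine (TopologicalSpace.isSeparable_range (ContinuousLinearMap.compL ℝ
    (EuclideanSpace ℝ (Fin n)) V Y V.subtypeL).continuous).mono ?_
  rintro T ⟨x, hT⟩
  exact ⟨T.codRestrict V (hT.apply_mem (Submodule.isClosed_topologicalClosure _) hfV),
    ContinuousLinearMap.ext fun _ => rfl⟩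

theorem IsCheegerDifferential.of_le (hT : IsCheegerDifferential D' φ f x T)
    (hD : ∀ x y, 0 ≤ D x y) (hDD' : ∀ x y, D x y ≤ D' x y) (hf : IsLipschitz D f)
    (hφ : IsLipschitz D φ) (h0 : lipAt D (fun y => f y - T (φ y)) x = 0) :
    IsCheegerDifferential D φ f x T :=
  ⟨h0, fun T' hT' => hT.2 T' <| nonpos_iff_eq_zero.1 <|
    ((hf.sub_linear_comp hφ T').lipAtWithin_anti hD hDD' univ x).trans_eq hT'⟩

theorem lipAt_sub_linear_comp_eq_zero_of_mem_closure {K : ENNReal} (hK : K ≠ ⊤) {L L' : ℝ}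
    (hφ : ∀ x y, dist (φ x) (φ y) ≤ L * D x y) (hφ' : ∀ x y, dist (φ x) (φ y) ≤ L' * D' x y)
    {𝒯 : Set (EuclideanSpace ℝ (Fin n) →L[ℝ] Y)}
    (h𝒯 : ∀ T₀ ∈ 𝒯, lipAt D (fun y => f y - T₀ (φ y)) x ≤
      K * lipAt D' (fun y => f y - T₀ (φ y)) x)
    {T : EuclideanSpace ℝ (Fin n) →L[ℝ] Y} (hT : T ∈ closure 𝒯)
    (h0 : lipAt D' (fun y => f y - T (φ y)) x = 0) :
    lipAt D (fun y => f y - T (φ y)) x = 0 := by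
  let F (T₀ : EuclideanSpace ℝ (Fin n) →L[ℝ] Y) : ENNReal :=
    K * ENNReal.ofReal (dist T₀ T * L') + ENNReal.ofReal (dist T T₀ * L)
  have hF : Continuous F :=
    ((ENNReal.continuous_const_mul hK).comp
      (ENNReal.continuous_ofReal.comp (by fun_prop))).add
      (ENNReal.continuous_ofReal.comp (by fun_prop))
  have hbound : 𝒯 ⊆ {T₀ | lipAt D (fun y => f y - T (φ y)) x ≤ F T₀} := fun T₀ hT₀ =>
    calc lipAt D (fun y => f y - T (φ y)) x
        ≤ lipAt D (fun y => f y - T₀ (φ y)) x + ENNReal.ofReal (dist T T₀ * L) :=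
          lipAtWithin_sub_linear_comp_le hφ T T₀
      _ ≤ K * lipAt D' (fun y => f y - T₀ (φ y)) x + ENNReal.ofReal (dist T T₀ * L) := by
          gcongr; exact h𝒯 T₀ hT₀
      _ ≤ K * (lipAt D' (fun y => f y - T (φ y)) x + ENNReal.ofReal (dist T₀ T * L')) +
            ENNReal.ofReal (dist T T₀ * L) := by
          gcongr; exact lipAtWithin_sub_linear_comp_le hφ' T₀ T
      _ = F T₀ := by rw [h0, zero_add]
  have hle : lipAt D (fun y => f y - T (φ y)) x ≤ F T :=
    closure_minimal hbound (isClosed_le continuous_const hF) hT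
  simpa [F] using hle

end Differentials

section Bad

variable {X Y : Type*} [NormedAddCommGroup Y] {J : ℕ → Set (Set X)} {δ η : ℕ → ℝ}
  {f g : X → Y} {x : X}

theorem dist_lt_of_notMem_largeShortcuts {ε : ℝ} {i : ℕ} {S : Set X} (hS : S ∈ J i)
    (hlarge : S ∉ largeShortcuts J δ η g ε i) (hbdd : Bornology.IsBounded (g '' S)) {z w : X}
    (hz : z ∈ S) (hw : w ∈ S) : dist (g z) (g w) < ε * (η i * δ i) :=
  calc dist (g z) (g w) ≤ Metric.diam (g '' S) :=
        Metric.dist_le_diam_of_mem hbdd (mem_image_of_mem g hz) (mem_image_of_mem g hw)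
    _ < ε * η i * δ i := lt_of_not_ge fun hle => hlarge ⟨hS, hle⟩
    _ = ε * (η i * δ i) := mul_assoc _ _ _

variable [MetricSpace X] {a a₀ b : ℝ}

theorem bad_congr
    (h : ∀ i, ∀ S ∈ J i, ∀ z ∈ S, ∀ w ∈ S, dist (f z) (f w) = dist (g z) (g w)) :
    bad J δ η f = bad J δ η g := by
  have hlarge (ε : ℝ) (i : ℕ) : largeShortcuts J δ η f ε i = largeShortcuts J δ η g ε i :=
    sep_ext_iff.2 fun S hS => by rw [diam_image_congr (h i S hS)]
  simp only [bad, badEps, hlarge]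

theorem ShortcutBounds.shortcutDist_le_mul_scale (hJ : ShortcutBounds J δ a a₀ b)
    (hη : ∀ i, 0 ≤ η i) {i : ℕ} {S : Set X} (hS : S ∈ J i) {z w : X} (hz : z ∈ S)
    (hw : w ∈ S) : shortcutDist J η z w ≤ a * (η i * δ i) :=
  calc shortcutDist J η z w ≤ η i * dist z w := shortcutDist_le_of_mem hη hS hz hw
    _ ≤ η i * (a * δ i) := mul_le_mul_of_nonneg_left (hJ.dist_le i S hS z hz w hw) (hη i)
    _ = a * (η i * δ i) := by ring

theorem ShortcutBounds.exists_dist_le_mul_scale (hJ : ShortcutBounds J δ a a₀ b)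
    (hη : ∀ i, 0 ≤ η i) (hg : IsLipschitz (shortcutDist J η) g) :
    ∃ L : ℝ, 0 ≤ L ∧ ∀ i, ∀ S ∈ J i, ∀ z ∈ S, ∀ w ∈ S, dist (g z) (g w) ≤ L * (η i * δ i) := by
  obtain ⟨L, hL, hg⟩ := hg
  refine ⟨L * a, mul_nonneg hL hJ.a_pos.le, fun i S hS z hz w hw => (hg z w).trans ?_⟩
  rw [mul_assoc]
  exact mul_le_mul_of_nonneg_left (hJ.shortcutDist_le_mul_scale hη hS hz hw) hL

theorem eventually_forall_lt_of_notMem_badEps {ε : ℝ} (hε : 0 < ε)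
    (hx : x ∉ badEps J δ η g ε) :
    ∀ᶠ i in atTop, ∀ S ∈ largeShortcuts J δ η g ε i, ∀ z ∈ S,
      η i * δ i < ε * shortcutDist J η z x := by
  rw [badEps, mem_limsup_iff_frequently_mem, not_frequently] at hx
  filter_upwards [hx] with i hi S hS z hz
  rw [← div_lt_iff₀' hε]
  exact lt_of_not_ge fun hle => hi <| show setDist _ _ x ≤ _ from
    iInf₂_le_of_le z (mem_sUnion_of_mem hz hS) (ENNReal.ofReal_le_ofReal hle)

theorem frequently_exists_lt_of_mem_badEps (hscale : ∀ i, 0 < η i * δ i) {ε : ℝ} (hε : 0 < ε)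
    (hx : x ∈ badEps J δ η g ε) :
    ∃ᶠ i in atTop, ∃ S ∈ largeShortcuts J δ η g ε i, ∃ z ∈ S,
      shortcutDist J η z x < 2 / ε * (η i * δ i) := by
  rw [badEps, mem_limsup_iff_frequently_mem] at hx
  refine hx.mono fun i hi => ?_
  have hlt : ENNReal.ofReal (η i * δ i / ε) < ENNReal.ofReal (2 / ε * (η i * δ i)) := by
    rw [ENNReal.ofReal_lt_ofReal_iff (mul_pos (by positivity) (hscale i)), div_mul_eq_mul_div]
    exact div_lt_div_of_pos_right (by linarith [hscale i]) hε
  obtain ⟨z, ⟨S, hS, hz⟩, hzx⟩ : ∃ z ∈ ⋃₀ largeShortcuts J δ η g ε i,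
      ENNReal.ofReal (shortcutDist J η z x) < ENNReal.ofReal (2 / ε * (η i * δ i)) := by
    simpa only [setDist, iInf_lt_iff, exists_prop] using lt_of_le_of_lt hi hlt
  exact ⟨S, hS, z, hz, (ENNReal.ofReal_lt_ofReal_iff (mul_pos (by positivity) (hscale i))).1 hzx⟩

theorem ShortcutBounds.eventually_dist_le_of_notMem_bad (hJ : ShortcutBounds J δ a a₀ b)
    (hη : ∀ i, 0 < η i) (hg : IsLipschitz (shortcutDist J η) g) (hx : x ∉ bad J δ η g) {κ : ℝ}
    (hκ : 0 < κ) : ∀ᶠ t in 𝓝[>] 0, ∀ i, ∀ S ∈ J i, ∀ z ∈ S, ∀ w ∈ S,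
      shortcutDist J η z x ≤ t → η i * δ i ≤ t → dist (g z) (g w) ≤ κ * t := by
  obtain ⟨L, hL, hosc⟩ := hJ.exists_dist_le_mul_scale (fun i => (hη i).le) hg
  have hscale (i : ℕ) : 0 < η i * δ i := mul_pos (hη i) (hJ.pos i)
  set ε := κ / (1 + L)
  have hε0 : 0 < ε := by positivity
  have hκε : κ = ε * (1 + L) := (div_mul_cancel₀ _ (by positivity)).symm
  obtain ⟨N, hN⟩ := eventually_atTop.1 <|
    eventually_forall_lt_of_notMem_badEps hε0 fun h => hx (mem_iUnion₂.2 ⟨ε, hε0, h⟩)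
  have hcoarse : ∀ᶠ t in 𝓝[>] (0 : ℝ), ∀ i ∈ Iio N, t < η i * δ i :=
    (eventually_all_finite (finite_Iio N)).2 fun i _ =>
      nhdsWithin_le_nhds (eventually_lt_nhds (hscale i))
  filter_upwards [hcoarse, self_mem_nhdsWithin] with t hcoarse ht i S hS z hz w hw hzx hit
  have hi : N ≤ i := le_of_not_gt fun hi => (hcoarse i hi).not_ge hit
  have hεt : 0 < ε * t := mul_pos hε0 ht
  by_cases hlarge : S ∈ largeShortcuts J δ η g ε i
  · calc dist (g z) (g w) ≤ L * (η i * δ i) := hosc i S hS z hz w hw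
      _ ≤ L * (ε * t) := by
          refine mul_le_mul_of_nonneg_left ((hN i hi S hlarge z hz).le.trans ?_) hL
          gcongr
      _ ≤ κ * t := by rw [hκε]; linarith
  · have hbdd : Bornology.IsBounded (g '' S) := Metric.isBounded_iff.2
      ⟨L * (η i * δ i), by rintro _ ⟨z, hz, rfl⟩ _ ⟨w, hw, rfl⟩; exact hosc i S hS z hz w hw⟩
    calc dist (g z) (g w) ≤ ε * (η i * δ i) :=
          (dist_lt_of_notMem_largeShortcuts hS hlarge hbdd hz hw).le
      _ ≤ ε * t := by gcongr
      _ ≤ κ * t := by rw [hκε]; linarith [mul_nonneg hL hεt.le]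

/-- The points at which `g` varies with slope at most `ε` on scales below `m`, with respect to the
original distance. Along a jump, `g` is controlled by slowness at the two ends and by its
oscillation on the shortcut. -/
def slowSet (g : X → Y) (ε m : ℝ) : Set X :=
  {u | ∀ y, dist u y < m → dist (g u) (g y) ≤ ε * dist u y}

theorem ShortcutBounds.exists_lipAt_shortcutDist_le (hJ : ShortcutBounds J δ a a₀ b)
    (hη : ∀ i, 0 < η i) (hη1 : ∀ i, η i ≤ 1) :
    ∃ K : ℝ, 0 < K ∧ ∀ g : X → Y, IsLipschitz (shortcutDist J η) g → ∀ ε m : ℝ, 0 < ε → 0 < m →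
      ∀ x ∈ slowSet g ε m, x ∉ bad J δ η g →
        ¬ IsPorousAt (shortcutDist J η) (slowSet g ε m) x →
          lipAt (shortcutDist J η) g x ≤ ENNReal.ofReal (K * ε) := by
  have hη0 (i : ℕ) : 0 ≤ η i := (hη i).le
  obtain ⟨C, hC, hjump⟩ := hJ.exists_dist_le_or_jump hη0 hη1
  have : 0 < C := zero_lt_one.trans_le hC
  refine ⟨6 * C, by positivity, fun g hg ε m hε hm x hx hbad hpor => ?_⟩
  have hosc := hJ.eventually_dist_le_of_notMem_bad hη hg hbad hε
  obtain ⟨s, hs, hosc⟩ := (nhdsGT_basis (0 : ℝ)).eventually_iff.1 hosc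
  refine (hg.lipAt_le_lipAtWithin (shortcutDist_nonneg hη0) (shortcutDist_triangle hη0)
    hpor).trans (lipAtWithin_le_ofReal (r := min s m / (2 * C)) (by positivity)
    fun u hu h0 hur => ?_)
  set t := C * (2 * shortcutDist J η x u) with ht
  have ht0 : 0 < t := by positivity
  rw [lt_div_iff₀ (by positivity), lt_min_iff] at hur
  have hts : t < s := by linarith
  have htm : t < m := by linarith
  have hslow {p q : X} (hp : p ∈ slowSet g ε m) (hpq : dist p q ≤ t) :
      dist (g p) (g q) ≤ ε * t :=
    (hp q (hpq.trans_lt htm)).trans (by gcongr)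
  have hεt : 0 < ε * t := mul_pos hε ht0
  suffices dist (g x) (g u) ≤ 3 * (ε * t) by linarith
  rcases hjump x u (2 * shortcutDist J η x u) (by linarith) with
    hxu | ⟨i, S, hS, z, hz, w, hw, hxz, hwu, hi⟩
  · linarith [hslow hx hxu]
  have hzx : shortcutDist J η z x ≤ t :=
    (shortcutDist_le_dist hη0 hη1 z x).trans (by rwa [dist_comm])
  have hgzw := hosc ⟨ht0, hts⟩ i S hS z hz w hw hzx hi
  have hguw := hslow hu (by rwa [dist_comm] : dist u w ≤ t)
  rw [dist_comm] at hguw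
  linarith [dist_triangle4 (g x) (g z) (g w) (g u), hslow hx hxz]

theorem ShortcutBounds.exists_ae_lipAt_shortcutDist_le_mul [MeasurableSpace X] {μ : Measure X}
    (hJ : ShortcutBounds J δ a a₀ b) (hη : ∀ i, 0 < η i) (hη1 : ∀ i, η i ≤ 1)
    (hpor : ∀ E, IsPorous (shortcutDist J η) E → μ E = 0) :
    ∃ K : ℝ, ∀ g : X → Y, IsLipschitz (shortcutDist J η) g → ∀ᵐ x ∂μ,
      x ∉ bad J δ η g → lipAt (shortcutDist J η) g x ≤ ENNReal.ofReal K * lipAt dist g x := by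
  obtain ⟨K, hK, hlip⟩ := hJ.exists_lipAt_shortcutDist_le (Y := Y) hη hη1
  refine ⟨K, fun g hg => ?_⟩
  have hslow : ∀ᵐ x ∂μ, ∀ (q : ℚ) (k : ℕ), x ∈ slowSet g q (1 / (k + 1)) →
      ¬ IsPorousAt (shortcutDist J η) (slowSet g q (1 / (k + 1))) x :=
    ae_all_iff.2 fun q => ae_all_iff.2 fun k => ae_not_isPorousAt hpor _
  filter_upwards [hslow] with x hslow hbad
  rw [← ENNReal.div_le_iff' (ENNReal.ofReal_pos.2 hK).ne' ENNReal.ofReal_ne_top]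
  refine le_of_forall_gt_imp_ge_of_dense fun c hc => ?_
  obtain ⟨q, -, hq, hqc⟩ := ENNReal.lt_iff_exists_rat_btwn.1 hc
  have hq0 : (0 : ℝ) < q := ENNReal.ofReal_pos.1 (hq.trans_le' bot_le)
  obtain ⟨r, hr, hrq⟩ := (hg.mono (shortcutDist_le_dist (fun i => (hη i).le)
    hη1)).exists_forall_dist_le_of_lipAtWithin_lt (fun _ _ => dist_nonneg) hq
  obtain ⟨k, hk⟩ := exists_nat_one_div_lt hr
  have hx : x ∈ slowSet g q (1 / (k + 1)) := fun y hy => hrq y (mem_univ y) (hy.trans hk)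
  rw [ENNReal.div_le_iff' (ENNReal.ofReal_pos.2 hK).ne' ENNReal.ofReal_ne_top]
  calc lipAt (shortcutDist J η) g x ≤ ENNReal.ofReal (K * q) :=
        hlip g hg q _ hq0 Nat.one_div_pos_of_nat x hx hbad (hslow q k hx)
    _ = ENNReal.ofReal K * ENNReal.ofReal q := ENNReal.ofReal_mul hK.le
    _ ≤ ENNReal.ofReal K * c := by gcongr; exact hqc.le

theorem ShortcutBounds.lipAt_shortcutDist_pos (hJ : ShortcutBounds J δ a a₀ b)
    (hη : ∀ i, 0 < η i) (hη1 : ∀ i, η i ≤ 1) (hg : IsLipschitz (shortcutDist J η) g)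
    (hx : x ∈ bad J δ η g) : 0 < lipAt (shortcutDist J η) g x := by
  have hη0 (i : ℕ) : 0 ≤ η i := (hη i).le
  have ha := hJ.a_pos
  obtain ⟨ε, hε, hxε⟩ := mem_iUnion₂.1 hx
  set R := 2 / ε + a with hR
  have hR0 : 0 < R := by positivity
  rw [pos_iff_ne_zero]
  intro h0
  obtain ⟨r, hr, hgr⟩ := hg.exists_forall_dist_le_of_lipAtWithin_lt (A := univ)
    (shortcutDist_nonneg hη0) (K := ε / (4 * R))
    (h0.trans_lt (ENNReal.ofReal_pos.2 (by positivity)))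
  have hsmall : ∀ᶠ i in atTop, R * δ i < r :=
    (hJ.tendsto.const_mul R).eventually_lt_const (by rwa [mul_zero])
  have hscale (i : ℕ) : 0 < η i * δ i := mul_pos (hη i) (hJ.pos i)
  obtain ⟨i, ⟨S, ⟨hS, hdiam⟩, s, hs, hsx⟩, hi⟩ :=
    ((frequently_exists_lt_of_mem_badEps hscale hε hxε).and_eventually hsmall).exists
  set t := η i * δ i
  have ht0 : 0 < t := hscale i
  have htr : R * t < r := hi.trans_le' <| by
    gcongr; exact mul_le_of_le_one_left (hJ.pos i).le (hη1 i)
  have hclose {z : X} (hz : z ∈ S) : dist (g x) (g z) ≤ ε / 4 * t := by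
    have hxz : shortcutDist J η x z ≤ R * t :=
      calc shortcutDist J η x z ≤ shortcutDist J η s x + shortcutDist J η s z := by
            rw [shortcutDist_comm hη0 s x]; exact shortcutDist_triangle hη0 x s z
        _ ≤ 2 / ε * t + a * t := add_le_add hsx.le (hJ.shortcutDist_le_mul_scale hη0 hS hs hz)
        _ = R * t := by rw [hR]; ring
    calc dist (g x) (g z) ≤ ε / (4 * R) * shortcutDist J η x z :=
          hgr z (mem_univ z) (hxz.trans_lt htr)
      _ ≤ ε / (4 * R) * (R * t) := by gcongr
      _ = ε / 4 * t := by field_simp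
  have hdiam_le : Metric.diam (g '' S) ≤ 2 * (ε / 4 * t) :=
    Metric.diam_le_of_subset_closedBall (by positivity) <| image_subset_iff.2 fun z hz =>
      Metric.mem_closedBall'.2 (hclose hz)
  linarith [mul_pos hε ht0, mul_assoc ε (η i) (δ i)]

end Bad

section AlmostEverywhere

variable {X Y : Type*} [MetricSpace X] [NormedAddCommGroup Y] [NormedSpace ℝ Y]
  {J : ℕ → Set (Set X)} {δ η : ℕ → ℝ} {a a₀ b : ℝ} {n : ℕ} {f : X → Y}
  {φ : X → EuclideanSpace ℝ (Fin n)}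

theorem IsLipschitz.continuous {Z : Type*} [PseudoMetricSpace Z] {g : X → Z}
    (hg : IsLipschitz dist g) : Continuous g := by
  obtain ⟨L, -, hg⟩ := hg
  exact (LipschitzWith.of_dist_le' hg).continuous

theorem IsMetricMeasureSpace.isSeparable_range {Z : Type*} [PseudoMetricSpace Z]
    [MeasurableSpace X] {μ : Measure X} (hμ : IsMetricMeasureSpace μ) {g : X → Z}
    (hg : IsLipschitz dist g) : TopologicalSpace.IsSeparable (range g) :=
  have := hμ.2.1
  TopologicalSpace.isSeparable_range hg.continuous

theorem bad_sub_linear_comp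
    (hconst : ∀ i, ∀ S ∈ J i, ∀ x ∈ S, ∀ y ∈ S, dist (φ x) (φ y) = 0)
    (T : EuclideanSpace ℝ (Fin n) →ₗ[ℝ] Y) :
    bad J δ η (fun y => f y - T (φ y)) = bad J δ η f :=
  bad_congr fun i S hS z hz w hw => by
    rw [eq_of_dist_eq_zero (hconst i S hS z hz w hw), dist_sub_right]

theorem IsCompatibleAtlas.dist_eq_zero [MeasurableSpace X] {μ : Measure X} {𝒜 : ChartFamily X}
    (h𝒜 : IsCompatibleAtlas Y μ J 𝒜) (hJ : HasShortcuts J δ) (j : 𝒜.ι) (i : ℕ) (S : Set X)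
    (hS : S ∈ J i) (x : X) (hx : x ∈ S) (y : X) (hy : y ∈ S) :
    dist (𝒜.φ j x) (𝒜.φ j y) = 0 := by
  obtain ⟨-, -, -, -, _, _, _, _, -, -, -, -, -, -, -, hcard, -⟩ := hJ
  refine le_antisymm ?_ dist_nonneg
  rw [← h𝒜.2 j i S hS]
  exact Metric.dist_le_diam_of_mem ((hcard i S hS).1.image _).isBounded
    (mem_image_of_mem _ hx) (mem_image_of_mem _ hy)

theorem ShortcutBounds.ae_isCheegerDifferential_shortcutDist [MeasurableSpace X] {μ : Measure X}
    (hJ : ShortcutBounds J δ a a₀ b) (hη : ∀ i, 0 < η i) (hη1 : ∀ i, η i ≤ 1)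
    (hpor : ∀ E, IsPorous (shortcutDist J η) E → μ E = 0)
    (hsep : TopologicalSpace.IsSeparable (range f)) (hf : IsLipschitz (shortcutDist J η) f)
    (hφ : IsLipschitz dist φ)
    (hconst : ∀ i, ∀ S ∈ J i, ∀ x ∈ S, ∀ y ∈ S, dist (φ x) (φ y) = 0) :
    ∀ᵐ x ∂μ, x ∉ bad J δ η f → ∀ T, IsCheegerDifferential dist φ f x T →
      IsCheegerDifferential (shortcutDist J η) φ f x T := by
  have hη0 (i : ℕ) : 0 ≤ η i := (hη i).le
  have hle := shortcutDist_le_dist (J := J) hη0 hη1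
  have hφη := hφ.shortcutDist_of_const hη0 hconst
  -- `Lip_{d_η}` need only be compared with `Lip_d` for the countably many maps `f - T₀ ∘ φ`, with
  -- `T₀` in a set whose closure contains all differentials of `f`.
  obtain ⟨𝒯, h𝒯, hdense⟩ := isSeparable_setOf_isCheegerDifferential dist φ hsep
  obtain ⟨K, hcompare⟩ := hJ.exists_ae_lipAt_shortcutDist_le_mul (Y := Y) hη hη1 hpor
  have hae : ∀ᵐ x ∂μ, ∀ T₀ ∈ 𝒯, x ∉ bad J δ η f →
      lipAt (shortcutDist J η) (fun y => f y - T₀ (φ y)) x ≤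
        ENNReal.ofReal K * lipAt dist (fun y => f y - T₀ (φ y)) x :=
    (ae_ball_iff h𝒯).2 fun T₀ _ => by
      rw [← bad_sub_linear_comp hconst (T₀ : EuclideanSpace ℝ (Fin n) →ₗ[ℝ] Y)]
      exact hcompare _ (hf.sub_linear_comp hφη (T₀ : EuclideanSpace ℝ (Fin n) →ₗ[ℝ] Y))
  filter_upwards [hae] with x hx hbad T hT
  have ⟨L, _, hφL⟩ := hφη
  have ⟨L', _, hφL'⟩ := hφ
  exact hT.of_le (shortcutDist_nonneg hη0) hle hf hφη <|
    lipAt_sub_linear_comp_eq_zero_of_mem_closure ENNReal.ofReal_ne_top hφL hφL'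
      (fun T₀ hT₀ => hx T₀ hT₀ hbad)
      (T := LinearMap.toContinuousLinearMap T) (hdense ⟨x, hT⟩) hT.1

theorem ShortcutBounds.ae_lipAtWithin_sub_linear_comp_pos [MeasurableSpace X] {μ : Measure X}
    (hJ : ShortcutBounds J δ a a₀ b) (hη : ∀ i, 0 < η i) (hη1 : ∀ i, η i ≤ 1)
    (hpor : ∀ E, IsPorous (shortcutDist J η) E → μ E = 0)
    (hf : IsLipschitz (shortcutDist J η) f) (hφ : IsLipschitz dist φ)
    (hconst : ∀ i, ∀ S ∈ J i, ∀ x ∈ S, ∀ y ∈ S, dist (φ x) (φ y) = 0)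
    {A : Set X} (hA : A ⊆ bad J δ η f) :
    ∀ᵐ x ∂μ, x ∈ A → ∀ T : EuclideanSpace ℝ (Fin n) →ₗ[ℝ] Y,
      0 < lipAtWithin (shortcutDist J η) A (fun y => f y - T (φ y)) x := by
  have hη0 (i : ℕ) : 0 ≤ η i := (hη i).le
  filter_upwards [ae_not_isPorousAt hpor A] with x hx hxA T
  have hg := hf.sub_linear_comp (hφ.shortcutDist_of_const hη0 hconst) T
  have hbad : x ∈ bad J δ η fun y => f y - T (φ y) :=
    (bad_sub_linear_comp hconst T).symm ▸ hA hxA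
  exact (hJ.lipAt_shortcutDist_pos hη hη1 hg hbad).trans_le <|
    hg.lipAt_le_lipAtWithin (shortcutDist_nonneg hη0) (shortcutDist_triangle hη0) (hx hxA)

end AlmostEverywhere

end Shortcut

theorem mainTheorem4_general {X : Type*} [MetricSpace X] [MeasurableSpace X]
    {Y : Type*} [NormedAddCommGroup Y] [NormedSpace ℝ Y]
    (μ : Measure X) (J : ℕ → Set (Set X)) (δ η : ℕ → ℝ) {a a₀ b : ℝ}
    (hη : ∀ i, 0 < η i ∧ η i ≤ 1) (hJ : Shortcut.ShortcutBounds J δ a a₀ b)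
    (hpor : ∀ E : Set X, Shortcut.IsPorous (Shortcut.shortcutDist J η) E → μ E = 0)
    (f : X → Y) (hf : Shortcut.IsLipschitz (Shortcut.shortcutDist J η) f)
    (hsep : TopologicalSpace.IsSeparable (range f))
    (𝒜 : Shortcut.ChartFamily X) (hφ : ∀ j, Shortcut.IsLipschitz dist (𝒜.φ j))
    (hconst : ∀ j, ∀ i, ∀ S ∈ J i, ∀ x ∈ S, ∀ y ∈ S, dist (𝒜.φ j x) (𝒜.φ j y) = 0)
    (hdiff : ∀ j, ∀ᵐ x ∂μ, x ∈ 𝒜.U j →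
      ∃ T, Shortcut.IsCheegerDifferential dist (𝒜.φ j) f x T) :
    (∀ j, ∀ᵐ x ∂μ, x ∈ 𝒜.U j \ Shortcut.bad J δ η f →
      ∃ T, Shortcut.IsCheegerDifferential (Shortcut.shortcutDist J η) (𝒜.φ j) f x T) ∧
    (∀ A ⊆ Shortcut.bad J δ η f, ∀ j, ∀ᵐ x ∂μ, x ∈ A ∩ 𝒜.U j →
      (∀ T : EuclideanSpace ℝ (Fin (𝒜.dim j)) →ₗ[ℝ] Y,
        0 < Shortcut.lipAt (Shortcut.shortcutDist J η) (fun y => f y - T (𝒜.φ j y)) x) ∧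
      (∀ T : EuclideanSpace ℝ (Fin (𝒜.dim j)) →ₗ[ℝ] Y,
        0 < Shortcut.lipAtWithin (Shortcut.shortcutDist J η) A
          (fun y => f y - T (𝒜.φ j y)) x)) ∧
    (∀ j, ∀ᵐ x ∂μ, x ∈ 𝒜.U j \ Shortcut.bad J δ η f →
      ∃ T, Shortcut.IsCheegerDifferential dist (𝒜.φ j) f x T ∧
        Shortcut.IsCheegerDifferential (Shortcut.shortcutDist J η) (𝒜.φ j) f x T) := by
  have hη0 (i : ℕ) : 0 < η i := (hη i).1
  have hη1 (i : ℕ) : η i ≤ 1 := (hη i).2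
  have hagree (j : 𝒜.ι) : ∀ᵐ x ∂μ, x ∈ 𝒜.U j \ Shortcut.bad J δ η f →
      ∃ T, Shortcut.IsCheegerDifferential dist (𝒜.φ j) f x T ∧
        Shortcut.IsCheegerDifferential (Shortcut.shortcutDist J η) (𝒜.φ j) f x T := by
    filter_upwards [hdiff j, hJ.ae_isCheegerDifferential_shortcutDist hη0 hη1 hpor hsep hf (hφ j)
      (hconst j)] with x hd hdη ⟨hxU, hxbad⟩
    exact (hd hxU).imp fun T hT => ⟨hT, hdη hxbad T hT⟩
  refine ⟨fun j => (hagree j).mono fun x h hx => (h hx).imp fun _ => And.right,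
    fun A hA j => ?_, hagree⟩
  filter_upwards [hJ.ae_lipAtWithin_sub_linear_comp_pos hη0 hη1 hpor hf (hφ j) (hconst j) hA]
    with x hx ⟨hxA, _⟩
  exact ⟨fun T => (hx hxA T).trans_le (Shortcut.lipAtWithin_mono (subset_univ A) _ x), hx hxA⟩

theorem mainTheorem4 {X : Type*} [MetricSpace X] [MeasurableSpace X]
    {Y : Type*} [NormedAddCommGroup Y] [NormedSpace ℝ Y] [CompleteSpace Y]
    (μ : Measure X) (J : ℕ → Set (Set X)) (δ η : ℕ → ℝ)
    (hη : ∀ i, 0 < η i ∧ η i ≤ 1)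
    (hX : Shortcut.IsLDSWithCompatibleShortcuts Y μ J δ)
    (hpor : ∀ E : Set X, Shortcut.IsPorous (Shortcut.shortcutDist J η) E → μ E = 0)
    (f : X → Y) (hf : Shortcut.IsLipschitz (Shortcut.shortcutDist J η) f)
    (𝒜 : Shortcut.ChartFamily X) (h𝒜 : Shortcut.IsCompatibleAtlas Y μ J 𝒜) :
    -- differentiability almost everywhere outside `Bad(f)`
    (∀ j, ∀ᵐ x ∂μ, x ∈ 𝒜.U j \ Shortcut.bad J δ η f →
      ∃ T, Shortcut.IsCheegerDifferential (Shortcut.shortcutDist J η) (𝒜.φ j) f x T) ∧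
    -- for every subset `A` of `Bad(f)`, at almost every point of `A` neither `f` nor its
    -- restriction to `(A, d_η)` is differentiable
    (∀ A ⊆ Shortcut.bad J δ η f, ∀ j, ∀ᵐ x ∂μ, x ∈ A ∩ 𝒜.U j →
      (∀ T : EuclideanSpace ℝ (Fin (𝒜.dim j)) →ₗ[ℝ] Y,
        0 < Shortcut.lipAt (Shortcut.shortcutDist J η) (fun y => f y - T (𝒜.φ j y)) x) ∧
      (∀ T : EuclideanSpace ℝ (Fin (𝒜.dim j)) →ₗ[ℝ] Y,
        0 < Shortcut.lipAtWithin (Shortcut.shortcutDist J η) A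
          (fun y => f y - T (𝒜.φ j y)) x)) ∧
    -- the differentials with respect to `d` and `d_η` agree almost everywhere outside `Bad(f)`
    (∀ j, ∀ᵐ x ∂μ, x ∈ 𝒜.U j \ Shortcut.bad J δ η f →
      ∃ T, Shortcut.IsCheegerDifferential dist (𝒜.φ j) f x T ∧
        Shortcut.IsCheegerDifferential (Shortcut.shortcutDist J η) (𝒜.φ j) f x T) := by
  obtain ⟨a, a₀, b, hJ⟩ := hX.2.1.exists_shortcutBounds
  have hfd := hf.mono (Shortcut.shortcutDist_le_dist (fun i => (hη i).1.le) fun i => (hη i).2)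
  exact mainTheorem4_general μ J δ η hη hJ hpor f hf (hX.1.1.isSeparable_range hfd) 𝒜 h𝒜.1.2.1
    (h𝒜.dist_eq_zero hX.2.1) (h𝒜.1.2.2.2 f hfd)
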